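/- Let $r,k,\ell$ be positive integers, $m=rk$, $n=r\ell$, let $p\in(0,1]$, let $\lambda_{\max}\ge \dfrac{1}{8(k\wedge\ell)p}$, and set $\sigma_1=\sqrt{(k\vee\ell)\lambda_{\max}}$ (so for $k\ge\ell$ the hypothesis reads $\lambda_{\max}\ge 1/(8\ell p)$ and $\sigma_1^2=k\lambda_{\max}$). Let $$S=\Big\{M\in[0,\lambda_{\max}]^{m\times n}:\ \operatorname{rank}(M)\le r,\ \sqrt{\max_i\textstyle\sum_j M_{ij}}+\sqrt{\max_j\textstyle\sum_i M_{ij}}\le 2\sigma_1\Big\}.$$ For $M\in S$ let $\mathbf P_M$ be the law of the following observation: a random set $\Omega\subset\{1,\dots,m\}\times\{1,\dots,n\}$ contains each position independently with probability $p$ and, conditionally on $\Omega$, independent counts $X_{ij}\sim\operatorname{Poisson}(M_{ij})$, $(i,j)\in\Omega$, are observed. Then $$\inf_{\widehat M}\ \sup_{M\in S}\ \mathbf P_M\!\left(\|\widehat M-M\|_F\ge\frac{\sqrt r\,\sigma_1}{8\sqrt{2p}}\right)\ \ge\ \frac12-\frac{8\log 2}{m\vee n},$$ where the infimum is over all estimators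 $\widehat M$, that is, all measurable functions of $\Omega$ and $(X_{ij})_{(i,j)\in\Omega}$ with values in $\mathbf R^{m\times n}$, and $\|\cdot\|_F$ is the Frobenius norm. -/

import Mathlib

open MeasureTheory ProbabilityTheory
open scoped ENNReal Matrix.Norms.Frobenius

noncomputable section

/-- The class of `m × n` matrices with entries in `[0, lam]`, of rank at most `r`, and such that
the square root of the largest row sum plus the square root of the largest column sum is at most
`2 * σ`. -/
def matrixClass (m n r : ℕ) (lam σ : ℝ) : Set (Matrix (Fin m) (Fin n) ℝ) :=
  {M | (∀ i j, M i j ∈ Set.Icc 0 lam) ∧ M.rank ≤ r ∧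
    √(⨆ i, ∑ j, M i j) + √(⨆ j, ∑ i, M i j) ≤ 2 * σ}

/-- What the statistician sees: the set of sampled positions together with the counts at those
positions (the counts at the positions that are not sampled are replaced by `0`). -/
abbrev Observation (m n : ℕ) : Type :=
  Set (Fin m × Fin n) × (Fin m × Fin n → ℕ)

open Classical in
/-- Mask the full matrix of counts `x` by the sampled set `s`. -/
def observe {m n : ℕ} (s : Set (Fin m × Fin n)) (x : Fin m × Fin n → ℕ) : Observation m n :=
  (s, fun e => if e ∈ s then x e else 0)

theorem measurable_observe {m n : ℕ} :
    Measurable (fun z : Set (Fin m × Fin n) × (Fin m × Fin n → ℕ) => observe z.1 z.2) := by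
  classical
  refine Measurable.prodMk measurable_fst (measurable_pi_iff.2 fun e => ?_)
  refine Measurable.ite ?_ ((measurable_pi_apply e).comp measurable_snd) measurable_const
  exact measurableSet_setOfPred.2 ((measurable_set_mem e).comp measurable_fst)

/-- The law of independent counts, the one at position `(i, j)` being Poisson with rate `M i j`. -/
def poissonLaw {m n : ℕ} (M : Matrix (Fin m) (Fin n) ℝ) : Measure (Fin m × Fin n → ℕ) :=
  Measure.pi fun e => poissonMeasure (M e.1 e.2).toNNReal

/-- The law of the observation when the rate matrix is `M`: every position is sampled
independently with probability `p`, independently of the Poisson counts, and the counts are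
seen at the sampled positions only. -/
def obsLaw {m n : ℕ} (p : unitInterval) (M : Matrix (Fin m) (Fin n) ℝ) :
    Measure (Observation m n) :=
  ((setBernoulli (Set.univ : Set (Fin m × Fin n)) p).prod (poissonLaw M)).map
    fun z => observe z.1 z.2

instance {m n : ℕ} (M : Matrix (Fin m) (Fin n) ℝ) : IsProbabilityMeasure (poissonLaw M) := by
  unfold poissonLaw; infer_instance

instance {m n : ℕ} (p : unitInterval) (M : Matrix (Fin m) (Fin n) ℝ) :
    IsProbabilityMeasure (obsLaw p M) :=
  Measure.isProbabilityMeasure_map measurable_observe.aemeasurable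

end

/-! Fano's method; by transposition assume `l ≤ k`. The test matrices have `r` diagonal blocks of
size `k × l`, each row being constant inside its block with value `lam` or `lam - δ`, where `δ ^ 2 =
lam / (8 * l * p)`. A Gilbert-Varshamov code of length `d = r * k` selects at least `exp (d / 8)` of
them, any two differing in at least `d / 4` rows, so their squared distance is at least `l * δ ^ 2 *
d / 4`, the square of twice the error threshold (`exists_separated_family`). The divergence from the
center `lam - δ / 2` is at most a chi-square sum, in which sampling contributes a factor `p`; it is
at most `d / 16` (`mul_obsLaw_real_le`). This is half of the lower bound `d / 8` on the
log-cardinality, whence the `1 / 2` in the conclusion (`ofReal_le_iSup_obsLaw_of_separated`). -/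

/-! ### Change of measure between products of Poisson laws. -/

theorem hasSum_poisson_mean (r : NNReal) :
    HasSum (fun n : ℕ => Real.exp (-r) * r ^ n / (n.factorial : ℝ) * n) (r : ℝ) := by
  rw [← hasSum_nat_add_iff' 1]
  simp only [Finset.range_one, Finset.sum_singleton, Nat.cast_zero, mul_zero, sub_zero]
  have h := (hasSum_one_poissonMeasure r).mul_left (r : ℝ)
  rw [mul_one] at h
  refine h.congr_fun (fun n => ?_)
  rw [Nat.factorial_succ]
  push_cast
  field_simp
  ring

theorem integrable_natCast_poissonMeasure (r : NNReal) :
    Integrable (fun n : ℕ => (n : ℝ)) (poissonMeasure r) := by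
  rw [integrable_poissonMeasure_iff]
  simpa using (hasSum_poisson_mean r).summable

theorem integral_natCast_poissonMeasure (r : NNReal) :
    ∫ n : ℕ, (n : ℝ) ∂poissonMeasure r = r := by
  rw [integral_poissonMeasure]
  simpa using (hasSum_poisson_mean r).tsum_eq

/-- An affine upper bound for the log-likelihood ratio of two Poisson laws. -/
noncomputable def poissonLogRatioBound (a c : NNReal) (x : ℕ) : ℝ := x * ((a : ℝ) / c - 1) + (c - a)

/-- The log-likelihood ratio is `x * log (a / c) + c - a`, and `log y ≤ y - 1`. If `c = 0`, both
laws are the point mass at `0`. -/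
theorem poissonMeasure_singleton_mul_exp_le {a c : NNReal} (h : c = 0 → a = 0) (x : ℕ) :
    poissonMeasure a {x} * ENNReal.ofReal (Real.exp (-poissonLogRatioBound a c x)) ≤
      poissonMeasure c {x} := by
  rw [poissonMeasure_singleton, poissonMeasure_singleton, ← ENNReal.ofReal_mul (by positivity)]
  refine ENNReal.ofReal_le_ofReal ?_
  rcases eq_or_ne c 0 with hc | hc
  · obtain rfl := h hc
    subst hc
    rcases Nat.eq_zero_or_pos x with rfl | hx
    · simp [poissonLogRatioBound]
    · simp [hx.ne']
  · have hc' : (0 : ℝ) < c := by positivity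
    have h1 : ((a : ℝ) / c) ^ x ≤ Real.exp (x * ((a : ℝ) / c - 1)) := by
      rw [Real.exp_nat_mul]
      gcongr
      have := Real.add_one_le_exp ((a : ℝ) / c - 1)
      linarith
    have h2 : Real.exp (-poissonLogRatioBound a c x) =
        Real.exp a * Real.exp (-c) / Real.exp (x * ((a : ℝ) / c - 1)) := by
      rw [← Real.exp_add, ← Real.exp_sub, poissonLogRatioBound]
      congr 1; ring
    rw [h2, Real.exp_neg (a : ℝ)]
    have h3 : (a : ℝ) ^ x = c ^ x * ((a : ℝ) / c) ^ x := by
      rw [← mul_pow]; congr 1; field_simp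
    rw [h3]
    calc _ = Real.exp (-c) * c ^ x / (x.factorial : ℝ) *
          (((a : ℝ) / c) ^ x / Real.exp (x * ((a : ℝ) / c - 1))) := by
          field_simp
      _ ≤ Real.exp (-c) * c ^ x / (x.factorial : ℝ) * 1 := by
          gcongr
          exact div_le_one_of_le₀ h1 (Real.exp_pos _).le
      _ = _ := mul_one _

/-- A linearized form of the Donsker-Varadhan inequality on a countable space. -/
theorem mul_measureReal_le_of_singleton {α : Type*} [MeasurableSpace α] [Countable α]
    [MeasurableSingletonClass α] (P Q : Measure α) [IsProbabilityMeasure P]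
    [IsProbabilityMeasure Q] {g : α → ℝ} (hg : Integrable g P)
    (h : ∀ x, P {x} * ENNReal.ofReal (Real.exp (-g x)) ≤ Q {x}) (A : Set α) (t : ℝ) :
    t * P.real A ≤ ∫ x, g x ∂P + Real.log 2 - 1 + (1 + (Real.exp t - 1) * Q.real A) / 2 := by
  classical
  have hA : MeasurableSet A := A.to_countable.measurableSet
  have hm : ∀ f : α → ℝ, Measurable f := fun _ => .of_discrete
  set f : α → ℝ := A.indicator fun _ => t with hf
  have hexp : ∀ x, Real.exp (f x) = 1 + A.indicator (fun _ => Real.exp t - 1) x := by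
    intro x
    by_cases hx : x ∈ A <;> simp [hf, hx]
  have hIQ : Integrable (fun x => Real.exp (f x)) Q := by
    simp_rw [hexp]
    exact (integrable_const _).add ((integrable_const _).indicator hA)
  have hQ : ∫ x, Real.exp (f x) ∂Q = 1 + (Real.exp t - 1) * Q.real A := by
    simp_rw [hexp]
    rw [integral_add (integrable_const _) ((integrable_const _).indicator hA),
      integral_indicator_const _ hA]
    simp [mul_comm]
  -- Only an inequality between point masses is needed, so no density is introduced.
  have hle : ∫⁻ x, ENNReal.ofReal (Real.exp (f x - g x)) ∂P ≤
      ∫⁻ x, ENNReal.ofReal (Real.exp (f x)) ∂Q := by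
    rw [lintegral_countable', lintegral_countable']
    refine ENNReal.tsum_le_tsum fun x => ?_
    rw [sub_eq_add_neg, Real.exp_add, ENNReal.ofReal_mul (Real.exp_pos _).le, mul_assoc,
      mul_comm (ENNReal.ofReal (Real.exp (-g x)))]
    gcongr
    exact h x
  have hlt : ∫⁻ x, ENNReal.ofReal (Real.exp (f x)) ∂Q < ∞ := by
    rw [← ofReal_integral_eq_lintegral_ofReal hIQ (ae_of_all _ fun _ => (Real.exp_pos _).le)]
    exact ENNReal.ofReal_lt_top
  have hIP : Integrable (fun x => Real.exp (f x - g x)) P := by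
    refine ⟨(hm _).aestronglyMeasurable, ?_⟩
    rw [hasFiniteIntegral_iff_ofReal (ae_of_all _ fun _ => (Real.exp_pos _).le)]
    exact hle.trans_lt hlt
  have hPQ : ∫ x, Real.exp (f x - g x) ∂P ≤ 1 + (Real.exp t - 1) * Q.real A := by
    rw [← hQ, integral_eq_lintegral_of_nonneg_ae (ae_of_all _ fun _ => (Real.exp_pos _).le)
      (hm _).aestronglyMeasurable, integral_eq_lintegral_of_nonneg_ae
      (ae_of_all _ fun _ => (Real.exp_pos _).le) (hm _).aestronglyMeasurable]
    exact ENNReal.toReal_mono hlt.ne hle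
  have hIf : Integrable f P := (integrable_const _).indicator hA
  -- This replaces the logarithm by its tangent at `2`, the value that the exponential moment stays
  -- below on average in Fano's argument.
  have hpt : ∀ x, f x - g x ≤ (Real.log 2 - 1) + Real.exp (f x - g x) / 2 := by
    intro x
    have := Real.add_one_le_exp (f x - g x - Real.log 2)
    rw [Real.exp_sub _ (Real.log 2), Real.exp_log two_pos] at this
    linarith
  have hmain : ∫ x, (f x - g x) ∂P ≤ ∫ x, ((Real.log 2 - 1) + Real.exp (f x - g x) / 2) ∂P :=
    integral_mono (hIf.sub hg) ((integrable_const _).add (hIP.div_const 2)) hpt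
  rw [integral_add (integrable_const _) (hIP.div_const 2), integral_div] at hmain
  rw [integral_sub hIf hg, hf, integral_indicator_const _ hA] at hmain
  simp only [integral_const, probReal_univ, smul_eq_mul, one_mul] at hmain
  rw [← hf] at hmain
  linarith

/-- The affine bound has mean `a * (a / c - 1) + (c - a) = (a - c) ^ 2 / c` under rate `a`, so the
chi-square sum plays the role of the divergence. -/
theorem mul_measureReal_pi_poisson_le {ι : Type*} [Fintype ι] (a c : ι → NNReal)
    (h : ∀ i, c i = 0 → a i = 0) (A : Set (ι → ℕ)) (t : ℝ) :
    t * (Measure.pi fun i => poissonMeasure (a i)).real A ≤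
      ∑ i, ((a i : ℝ) - c i) ^ 2 / c i + Real.log 2 - 1 +
        (1 + (Real.exp t - 1) * (Measure.pi fun i => poissonMeasure (c i)).real A) / 2 := by
  have hi : ∀ i, Integrable (poissonLogRatioBound (a i) (c i)) (poissonMeasure (a i)) := fun i =>
    ((integrable_natCast_poissonMeasure _).mul_const _).add (integrable_const _)
  have hI : ∀ i, Integrable (fun x : ι → ℕ => poissonLogRatioBound (a i) (c i) (x i))
      (Measure.pi fun i => poissonMeasure (a i)) := fun i =>
    integrable_comp_eval (μ := fun i => poissonMeasure (a i)) (hi i)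
  have key := mul_measureReal_le_of_singleton (Measure.pi fun i => poissonMeasure (a i))
    (Measure.pi fun i => poissonMeasure (c i))
    (g := fun x => ∑ i, poissonLogRatioBound (a i) (c i) (x i))
    (integrable_finsetSum _ fun i _ => hI i) ?_ A t
  · rw [integral_finsetSum _ fun i _ => hI i] at key
    have : ∀ i, ∫ x : ι → ℕ, poissonLogRatioBound (a i) (c i) (x i)
        ∂(Measure.pi fun i => poissonMeasure (a i)) = ((a i : ℝ) - c i) ^ 2 / c i := by
      intro i
      rw [integral_comp_eval (μ := fun i => poissonMeasure (a i))
        (f := poissonLogRatioBound (a i) (c i)) (hi i).aestronglyMeasurable]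
      unfold poissonLogRatioBound
      rw [integral_add ((integrable_natCast_poissonMeasure _).mul_const _) (integrable_const _),
        integral_mul_const, integral_natCast_poissonMeasure]
      simp only [integral_const, probReal_univ, smul_eq_mul, one_mul]
      rcases eq_or_ne (c i) 0 with hc | hc
      · simp [hc, h i hc]
      · have : (c i : ℝ) ≠ 0 := by exact_mod_cast hc
        field_simp
        ring
    simpa only [this] using key
  · intro x
    rw [Measure.pi_singleton, Measure.pi_singleton, ← Finset.sum_neg_distrib, Real.exp_sum,
      ENNReal.ofReal_prod_of_nonneg fun i _ => (Real.exp_pos _).le, ← Finset.prod_mul_distrib]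
    exact Finset.prod_le_prod' fun i _ => poissonMeasure_singleton_mul_exp_le (h i) _

/-! ### The partially observed model. -/

theorem poissonMeasure_zero : poissonMeasure 0 = Measure.dirac 0 := by
  refine Measure.ext_of_singleton fun n => ?_
  rw [poissonMeasure_singleton]
  rcases Nat.eq_zero_or_pos n with rfl | hn
  · simp
  · simp [hn.ne', hn.ne]

-- A masked count is constantly `0`, that is, Poisson of rate `0`; for a fixed sampled set the
-- observed counts are again a product of Poisson laws.
open Classical in
theorem poissonLaw_real_mask {m n : ℕ} (M : Matrix (Fin m) (Fin n) ℝ)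
    (s : Set (Fin m × Fin n)) (A : Set (Observation m n)) :
    (poissonLaw M).real {x | observe s x ∈ A} =
      (Measure.pi fun e => poissonMeasure (if e ∈ s then (M e.1 e.2).toNNReal else 0)).real
        {x | (s, x) ∈ A} := by
  have h : (fun e => poissonMeasure (if e ∈ s then (M e.1 e.2).toNNReal else 0)) = fun e =>
      (poissonMeasure (M e.1 e.2).toNNReal).map fun x : ℕ => if e ∈ s then x else 0 := by
    funext e
    by_cases he : e ∈ s
    · simp [he]
    · simp [he, poissonMeasure_zero]
  have hp : ∀ e : Fin m × Fin n, IsProbabilityMeasure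
      ((poissonMeasure (M e.1 e.2).toNNReal).map fun x : ℕ => if e ∈ s then x else 0) :=
    fun e => Measure.isProbabilityMeasure_map (Measurable.of_discrete).aemeasurable
  rw [h, ← Measure.pi_map_pi fun e => (Measurable.of_discrete).aemeasurable, map_measureReal_apply]
  · rfl
  · exact measurable_pi_iff.2 fun e =>
      (Measurable.of_discrete (f := fun x : ℕ => if e ∈ s then x else 0)).comp
        (measurable_pi_apply e)
  · exact (Set.to_countable _).measurableSet

theorem setBernoulli_real_mem {ι : Type*} (p : unitInterval) (i : ι) :
    (setBernoulli (Set.univ : Set ι) p).real {s | i ∈ s} = p := by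
  have h := measurePreserving_eval_infinitePi
    (fun j : ι => unitInterval.toNNReal p • Measure.dirac (j ∈ (Set.univ : Set ι)) +
      unitInterval.toNNReal (unitInterval.symm p) • Measure.dirac False) i
  have h2 := h.measure_preimage (s := {True}) (measurableSet_singleton _).nullMeasurableSet
  rw [measureReal_def, setBernoulli_apply']
  have h3 : (fun p : ι → Prop => {i | p i}) ⁻¹' {s | i ∈ s} =
      (Function.eval i : (ι → Prop) → Prop) ⁻¹' {True} := by
    ext; simp
  rw [h3, h2]
  simp

theorem obsLaw_real {m n : ℕ} (p : unitInterval) (M : Matrix (Fin m) (Fin n) ℝ)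
    {A : Set (Observation m n)} (hA : MeasurableSet A) :
    (obsLaw p M).real A = ∫ s, (poissonLaw M).real {x | observe s x ∈ A}
      ∂setBernoulli (Set.univ : Set (Fin m × Fin n)) p := by
  rw [obsLaw, map_measureReal_apply measurable_observe hA,
    measureReal_def, Measure.prod_apply (measurable_observe hA)]
  exact (integral_toReal (measurable_measure_prodMk_left (measurable_observe hA)).aemeasurable
    (ae_of_all _ fun _ => measure_lt_top _ _)).symm

/-- Given the sampled set, unsampled positions have rate `0` under both laws and contribute nothing.
The bound is affine in the two probabilities, so it can be averaged over the sampled set, and each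
position then has weight `p`. -/
theorem mul_obsLaw_real_le {m n : ℕ} (p : unitInterval) (M C : Matrix (Fin m) (Fin n) ℝ)
    (hM : ∀ i j, 0 ≤ M i j) (hC : ∀ i j, 0 ≤ C i j) (h : ∀ i j, C i j = 0 → M i j = 0)
    {A : Set (Observation m n)} (hA : MeasurableSet A) (t : ℝ) :
    t * (obsLaw p M).real A ≤ p * ∑ i, ∑ j, (M i j - C i j) ^ 2 / C i j + Real.log 2 - 1 +
      (1 + (Real.exp t - 1) * (obsLaw p C).real A) / 2 := by
  classical
  have hpt : ∀ s : Set (Fin m × Fin n), t * (poissonLaw M).real {x | observe s x ∈ A} ≤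
      ∑ e : Fin m × Fin n,
        {s : Set (Fin m × Fin n) | e ∈ s}.indicator
          (fun _ => (M e.1 e.2 - C e.1 e.2) ^ 2 / C e.1 e.2) s + Real.log 2 - 1 +
        (1 + (Real.exp t - 1) * (poissonLaw C).real {x | observe s x ∈ A}) / 2 := by
    intro s
    rw [poissonLaw_real_mask, poissonLaw_real_mask]
    refine (mul_measureReal_pi_poisson_le _
      (fun e : Fin m × Fin n => if e ∈ s then (C e.1 e.2).toNNReal else 0) ?_ _ t).trans_eq ?_
    · intro e
      by_cases he : e ∈ s
      · simp only [he, if_true, Real.toNNReal_eq_zero]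
        intro h0
        exact (h _ _ (le_antisymm h0 (hC _ _))).le
      · simp [he]
    · congr 3
      refine Finset.sum_congr rfl fun e _ => ?_
      by_cases he : e ∈ s
      · simp [he, hM, hC]
      · simp [he]
  have hint : ∀ f : Set (Fin m × Fin n) → ℝ,
      Integrable f (setBernoulli (Set.univ : Set (Fin m × Fin n)) p) := fun f =>
    Integrable.of_finite
  have hi := integral_mono (hint _) (hint _) hpt
  rw [obsLaw_real p M hA, obsLaw_real p C hA]
  rw [integral_const_mul, integral_add (hint _) (hint _), integral_sub (hint _) (hint _),
    integral_add (hint _) (hint _), integral_finsetSum _ fun _ _ => hint _, integral_div,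
    integral_add (hint _) (hint _), integral_const_mul] at hi
  refine hi.trans_eq ?_
  simp only [integral_const, probReal_univ, smul_eq_mul, one_mul]
  congr 3
  rw [Fintype.sum_prod_type, Finset.mul_sum]
  refine Finset.sum_congr rfl fun i _ => ?_
  rw [Finset.mul_sum]
  refine Finset.sum_congr rfl fun j _ => ?_
  rw [integral_indicator_const _ (measurableSet_setOfPred.2 (measurable_set_mem _)),
    setBernoulli_real_mem, smul_eq_mul]

/-! ### Packing the hypercube. -/

theorem sum_exp_neg_hammingDist_le {ι : Type*} [Fintype ι] [DecidableEq ι] (v : ι → Bool) :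
    ∑ w : ι → Bool, Real.exp (-(hammingDist v w : ℝ)) ≤
      2 ^ Fintype.card ι * Real.exp (-(3 / 8) * (Fintype.card ι : ℝ)) := by
  have h1 : ∀ w : ι → Bool, Real.exp (-(hammingDist v w : ℝ)) =
      ∏ i, if v i ≠ w i then Real.exp (-1) else 1 := by
    intro w
    rw [Finset.prod_ite, Finset.prod_const, Finset.prod_const_one, mul_one, ← Real.exp_nat_mul]
    simp [hammingDist]
  have h2 : ∀ i, ∑ b : Bool, (if v i ≠ b then Real.exp (-1) else 1) = 1 + Real.exp (-1) := by
    intro i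
    cases v i <;> simp [add_comm]
  -- The sum factors over coordinates; each factor is `2 * exp (-1/2) * cosh (1/2)`, and `cosh x ≤
  -- exp (x ^ 2 / 2)`.
  have h3 : 1 + Real.exp (-1) ≤ 2 * Real.exp (-(3 / 8)) := by
    have hc := Real.cosh_le_exp_half_sq (1 / 2)
    have he : 1 + Real.exp (-1) = 2 * Real.exp (-(1 / 2)) * Real.cosh (1 / 2) := by
      rw [Real.cosh_eq, mul_div_assoc', mul_assoc, mul_add, ← Real.exp_add, ← Real.exp_add]
      norm_num
    rw [he, show (-(3 / 8) : ℝ) = -(1 / 2) + (1 / 2) ^ 2 / 2 by norm_num, Real.exp_add, mul_assoc]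
    gcongr
  simp_rw [h1]
  rw [← Fintype.prod_sum fun i b => if v i ≠ b then Real.exp (-1) else 1]
  simp_rw [h2]
  rw [Finset.prod_const, Finset.card_univ, mul_comm (-(3 / 8) : ℝ), Real.exp_nat_mul, ← mul_pow]
  gcongr

/-- Chernoff's bound, with exponent `1/4 - 3/8 = -1/8` per coordinate. -/
theorem card_hammingBall_le {ι : Type*} [Fintype ι] [DecidableEq ι] (v : ι → Bool) :
    ((Finset.univ.filter fun w : ι → Bool =>
      (hammingDist v w : ℝ) < Fintype.card ι / 4).card : ℝ) ≤
      2 ^ Fintype.card ι * Real.exp (-((Fintype.card ι : ℝ) / 8)) := by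
  have h := sum_exp_neg_hammingDist_le v
  calc _ = ∑ w ∈ Finset.univ.filter fun w : ι → Bool =>
        (hammingDist v w : ℝ) < Fintype.card ι / 4, (1 : ℝ) := by simp
    _ ≤ ∑ w ∈ Finset.univ.filter fun w : ι → Bool =>
        (hammingDist v w : ℝ) < Fintype.card ι / 4,
        Real.exp ((Fintype.card ι : ℝ) / 4) * Real.exp (-(hammingDist v w : ℝ)) := by
        refine Finset.sum_le_sum fun w hw => ?_
        rw [← Real.exp_add]
        refine Real.one_le_exp ?_
        have := (Finset.mem_filter.1 hw).2
        linarith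
    _ ≤ ∑ w : ι → Bool,
        Real.exp ((Fintype.card ι : ℝ) / 4) * Real.exp (-(hammingDist v w : ℝ)) :=
        Finset.sum_le_sum_of_subset_of_nonneg (Finset.filter_subset _ _)
          fun _ _ _ => by positivity
    _ ≤ Real.exp ((Fintype.card ι : ℝ) / 4) *
        (2 ^ Fintype.card ι * Real.exp (-(3 / 8) * (Fintype.card ι : ℝ))) := by
        rw [← Finset.mul_sum]
        gcongr
    _ = _ := by
        rw [mul_left_comm, ← Real.exp_add]
        congr 2
        ring

/-- The Gilbert-Varshamov bound on the hypercube. -/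
theorem exists_hammingDist_packing (ι : Type*) [Fintype ι] [DecidableEq ι] :
    ∃ T : Finset (ι → Bool), Real.exp ((Fintype.card ι : ℝ) / 8) ≤ T.card ∧
      ∀ v ∈ T, ∀ w ∈ T, v ≠ w → (Fintype.card ι : ℝ) / 4 ≤ hammingDist v w := by
  classical
  obtain ⟨T, hT, hmax⟩ := Finset.exists_max_image
    (Finset.univ.filter fun T : Finset (ι → Bool) =>
      ∀ v ∈ T, ∀ w ∈ T, v ≠ w → (Fintype.card ι : ℝ) / 4 ≤ hammingDist v w)
    Finset.card ⟨∅, by simp⟩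
  have hT := (Finset.mem_filter.1 hT).2
  refine ⟨T, ?_, hT⟩
  -- By maximality the balls around `T` cover the cube. The center is inserted because the strict
  -- ball is empty when `ι` is.
  have hcover : (Finset.univ : Finset (ι → Bool)) ⊆ T.biUnion fun v =>
      insert v (Finset.univ.filter fun w : ι → Bool =>
        (hammingDist v w : ℝ) < Fintype.card ι / 4) := by
    intro w _
    by_contra hw
    simp only [Finset.mem_biUnion, Finset.mem_insert, Finset.mem_filter, Finset.mem_univ, true_and,
      not_exists, not_and, not_or, not_lt] at hw
    have hwT : w ∉ T := fun h => (hw w h).1 rfl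
    have := hmax (insert w T) (Finset.mem_filter.2 ⟨Finset.mem_univ _, ?_⟩)
    · rw [Finset.card_insert_of_notMem hwT] at this
      omega
    · intro a ha b hb hab
      rcases Finset.mem_insert.1 ha with rfl | ha' <;> rcases Finset.mem_insert.1 hb with rfl | hb'
      · exact absurd rfl hab
      · rw [hammingDist_comm]; exact (hw b hb').2
      · exact (hw a ha').2
      · exact hT a ha' b hb' hab
  have hne : T.Nonempty := by
    obtain ⟨v, hv, -⟩ := Finset.mem_biUnion.1 (hcover (Finset.mem_univ fun _ => true))
    exact ⟨v, hv⟩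
  rcases isEmpty_or_nonempty ι with hι | hι
  · simpa using Finset.card_pos.2 hne
  have hins : ∀ v : ι → Bool, insert v (Finset.univ.filter fun w : ι → Bool =>
        (hammingDist v w : ℝ) < Fintype.card ι / 4) = Finset.univ.filter fun w : ι → Bool =>
        (hammingDist v w : ℝ) < Fintype.card ι / 4 := fun v =>
    Finset.insert_eq_of_mem (by simpa using Fintype.card_pos)
  simp_rw [hins] at hcover
  have h1 : (2 : ℝ) ^ Fintype.card ι ≤
      T.card * (2 ^ Fintype.card ι * Real.exp (-((Fintype.card ι : ℝ) / 8))) := by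
    calc (2 : ℝ) ^ Fintype.card ι = ((Finset.univ : Finset (ι → Bool)).card : ℝ) := by simp
      _ ≤ ∑ v ∈ T, ((Finset.univ.filter fun w : ι → Bool =>
        (hammingDist v w : ℝ) < Fintype.card ι / 4).card : ℝ) := by
        exact_mod_cast (Finset.card_le_card hcover).trans Finset.card_biUnion_le
      _ ≤ ∑ v ∈ T, (2 ^ Fintype.card ι * Real.exp (-((Fintype.card ι : ℝ) / 8))) :=
        Finset.sum_le_sum fun v _ => card_hammingBall_le v
      _ = _ := by rw [Finset.sum_const, nsmul_eq_mul]
  rw [Real.exp_neg, mul_left_comm, ← div_eq_mul_inv] at h1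
  have h2 : 1 ≤ (T.card : ℝ) / Real.exp ((Fintype.card ι : ℝ) / 8) :=
    le_of_mul_le_mul_left (by simpa using h1) (by positivity : (0 : ℝ) < 2 ^ Fintype.card ι)
  exact (one_le_div (Real.exp_pos _)).1 h2

/-! ### Fano's inequality. -/

theorem frobenius_norm_sq {m n : Type*} [Fintype m] [Fintype n] (A : Matrix m n ℝ) :
    ‖A‖ ^ 2 = ∑ i, ∑ j, A i j ^ 2 := by
  rw [Matrix.frobenius_norm_def, ← Real.sqrt_eq_rpow, Real.sq_sqrt (by positivity)]
  simp

theorem measurable_norm_estimator_sub {m n : ℕ} {α : Type*} [MeasurableSpace α]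
    {f : α → Matrix (Fin m) (Fin n) ℝ} (hf : ∀ i j, Measurable fun y => f y i j)
    (M : Matrix (Fin m) (Fin n) ℝ) : Measurable fun y => ‖f y - M‖ := by
  have h : (fun y => ‖f y - M‖) = fun y => √(∑ i, ∑ j, (f y i j - M i j) ^ 2) := by
    funext y
    rw [← Real.sqrt_sq (norm_nonneg (f y - M)), frobenius_norm_sq]
    rfl
  rw [h]
  fun_prop

/-- Fano's inequality for a finite family of rate matrices that are pairwise separated and whose
laws are close, in Kullback-Leibler divergence, to the law of a common center. -/
theorem ofReal_le_iSup_obsLaw_of_separated {m n : ℕ} (p : unitInterval)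
    (S : Set (Matrix (Fin m) (Fin n) ℝ)) {ι : Type*} [Fintype ι]
    (M : ι → Matrix (Fin m) (Fin n) ℝ) (C : Matrix (Fin m) (Fin n) ℝ) (hMS : ∀ v, M v ∈ S)
    (hM : ∀ v i j, 0 ≤ M v i j) (hC : ∀ i j, 0 ≤ C i j) (hMC : ∀ v i j, C i j = 0 → M v i j = 0)
    {d : ℕ} (hd : 0 < d) (hcard : Real.exp (d / 8) ≤ Fintype.card ι)
    (hdiv : ∀ v, p * ∑ i, ∑ j, (M v i j - C i j) ^ 2 / C i j ≤ (d : ℝ) / 16) {ε : ℝ}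
    (hsep : ∀ v w, v ≠ w → 2 * ε ≤ ‖M v - M w‖)
    {f : Observation m n → Matrix (Fin m) (Fin n) ℝ} (hf : ∀ i j, Measurable fun y => f y i j) :
    ENNReal.ofReal (1 / 2 - 8 * Real.log 2 / d) ≤
      ⨆ M ∈ S, obsLaw p M {y | ε ≤ ‖f y - M‖} := by
  classical
  set N : ℝ := (Fintype.card ι : ℝ) with hN
  have hd' : (0 : ℝ) < d := by exact_mod_cast hd
  have hN1 : 1 < N := lt_of_lt_of_le (Real.one_lt_exp_iff.2 (by positivity)) hcard
  have hNι : Nonempty ι := by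
    refine Fintype.card_pos_iff.1 ?_
    have : (0 : ℝ) < Fintype.card ι := by linarith
    exact_mod_cast this
  have hlog : (d : ℝ) / 8 ≤ Real.log N := (Real.le_log_iff_exp_le (by linarith)).2 hcard
  have hA : ∀ v, MeasurableSet {y | ‖f y - M v‖ < ε} := fun v =>
    measurableSet_lt (measurable_norm_estimator_sub hf _) measurable_const
  -- Separation makes the success events disjoint, and all are measured under the one central law.
  have hdisj : ∑ v, (obsLaw p C).real {y | ‖f y - M v‖ < ε} ≤ 1 := by
    rw [← measureReal_iUnion_fintype ?_ hA]
    · exact measureReal_le_one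
    · intro v w hvw
      refine Set.disjoint_left.2 fun y hv hw => ?_
      have h1 := norm_sub_le_norm_sub_add_norm_sub (M v) (f y) (M w)
      rw [norm_sub_rev (M v) (f y)] at h1
      have h2 := hsep v w hvw
      have hv : ‖f y - M v‖ < ε := hv
      have hw : ‖f y - M w‖ < ε := hw
      linarith
  -- With `t = log N`, failure at every `v` would force each `(N - 1) * Q(A v) > 1`, where `Q` is
  -- the central law and `A v` the success event; summing gives `N < N - 1`.
  obtain ⟨v, hv⟩ : ∃ v, Real.log N * (obsLaw p (M v)).real {y | ‖f y - M v‖ < ε} ≤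
      d / 16 + Real.log 2 := by
    by_contra! hcon
    have h1 : ∀ v, d / 16 + Real.log 2 < d / 16 + Real.log 2 - 1 +
        (1 + (N - 1) * (obsLaw p C).real {y | ‖f y - M v‖ < ε}) / 2 := by
      intro v
      have h2 := mul_obsLaw_real_le p (M v) C (hM v) hC (hMC v) (hA v) (Real.log N)
      rw [Real.exp_log (by linarith)] at h2
      linarith [hcon v, hdiv v]
    have h3 : ∀ v, 1 < (N - 1) * (obsLaw p C).real {y | ‖f y - M v‖ < ε} := fun v => by
      linarith [h1 v]
    have h4 := Finset.sum_lt_sum_of_nonempty Finset.univ_nonempty fun v _ => h3 v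
    rw [← Finset.mul_sum] at h4
    simp only [Finset.sum_const, Finset.card_univ, nsmul_eq_mul, mul_one] at h4
    nlinarith
  refine le_iSup₂_of_le (M v) (hMS v) ?_
  have hcompl : {y | ε ≤ ‖f y - M v‖} = {y | ‖f y - M v‖ < ε}ᶜ := by
    ext; simp
  rw [hcompl, ← ofReal_measureReal, probReal_compl_eq_one_sub (hA v)]
  refine ENNReal.ofReal_le_ofReal ?_
  have h0 : (d : ℝ) / 8 * (obsLaw p (M v)).real {y | ‖f y - M v‖ < ε} ≤ d / 16 + Real.log 2 :=
    (mul_le_mul_of_nonneg_right hlog measureReal_nonneg).trans hv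
  have h5 : (obsLaw p (M v)).real {y | ‖f y - M v‖ < ε} ≤ (d / 16 + Real.log 2) / (d / 8) := by
    rw [le_div_iff₀ (by positivity)]
    linarith
  have h6 : (d / 16 + Real.log 2) / (d / 8) = 1 / 2 + 8 * Real.log 2 / d := by
    field_simp
    ring
  linarith

/-! ### The block matrices and their separated subfamily. -/

/-- The matrix made of `r` diagonal blocks of size `k × l`, with row `i` equal to `u i` inside the
block that it meets. -/
def blockMatrix (r k l : ℕ) (u : Fin (r * k) → ℝ) : Matrix (Fin (r * k)) (Fin (r * l)) ℝ :=
  Matrix.of fun i j => if i.divNat = j.divNat then u i else 0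

theorem sum_ite_divNat (r l : ℕ) (b : Fin r) (x : ℝ) :
    ∑ j : Fin (r * l), (if b = j.divNat then x else 0) = l * x := by
  rw [← finProdFinEquiv.sum_comp, Fintype.sum_prod_type]
  have h : ∀ (c : Fin r) (y : Fin l), (finProdFinEquiv (c, y)).divNat = c := fun c y =>
    congrArg Prod.fst (finProdFinEquiv.symm_apply_apply (c, y))
  simp [h]

theorem rank_blockMatrix_le (r k l : ℕ) (u : Fin (r * k) → ℝ) :
    (blockMatrix r k l u).rank ≤ r := by
  have h : blockMatrix r k l u =
      (Matrix.of fun (i : Fin (r * k)) (b : Fin r) => if i.divNat = b then u i else 0) *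
      (Matrix.of fun (b : Fin r) (j : Fin (r * l)) => if b = j.divNat then (1 : ℝ) else 0) := by
    ext i j
    simp [blockMatrix, Matrix.mul_apply]
  rw [h]
  refine (Matrix.rank_mul_le_left _ _).trans ((Matrix.rank_le_width _).trans_eq ?_)
  simp

/-- A row meets `l ≤ k` nonzero columns and a column meets `k` rows, so both kinds of sums are at
most `k * lam`. -/
theorem blockMatrix_mem_matrixClass {r k l : ℕ} (hr : 0 < r) (hlk : l ≤ k) (hl : 0 < l)
    {lam : ℝ} {u : Fin (r * k) → ℝ} (hu : ∀ i, u i ∈ Set.Icc 0 lam) :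
    blockMatrix r k l u ∈ matrixClass (r * k) (r * l) r lam √(k * lam) := by
  have hk : 0 < k := hl.trans_le hlk
  have hm : Nonempty (Fin (r * k)) := ⟨⟨0, by positivity⟩⟩
  have hn : Nonempty (Fin (r * l)) := ⟨⟨0, by positivity⟩⟩
  have hlam : 0 ≤ lam := (hu hm.some).1.trans (hu hm.some).2
  have hlk' : (l : ℝ) ≤ k := by exact_mod_cast hlk
  refine ⟨fun i j => ?_, rank_blockMatrix_le _ _ _ _, ?_⟩
  · simp only [blockMatrix, Matrix.of_apply]
    split_ifs
    · exact hu i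
    · exact ⟨le_rfl, hlam⟩
  · rw [two_mul]
    refine add_le_add (Real.sqrt_le_sqrt (ciSup_le fun i => ?_))
      (Real.sqrt_le_sqrt (ciSup_le fun j => ?_))
    · simp only [blockMatrix, Matrix.of_apply]
      rw [sum_ite_divNat]
      exact mul_le_mul hlk' (hu i).2 (hu i).1 (Nat.cast_nonneg k)
    · rw [← sum_ite_divNat r k j.divNat lam]
      refine Finset.sum_le_sum fun i _ => ?_
      simp only [blockMatrix, Matrix.of_apply, eq_comm (a := j.divNat)]
      split_ifs
      · exact (hu i).2
      · exact le_rfl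

theorem norm_sq_blockMatrix_sub (r k l : ℕ) (u v : Fin (r * k) → ℝ) :
    ‖blockMatrix r k l u - blockMatrix r k l v‖ ^ 2 = l * ∑ i, (u i - v i) ^ 2 := by
  rw [frobenius_norm_sq, Finset.mul_sum]
  refine Finset.sum_congr rfl fun i _ => ?_
  rw [← sum_ite_divNat r l i.divNat]
  refine Finset.sum_congr rfl fun j _ => ?_
  simp only [blockMatrix, Matrix.sub_apply, Matrix.of_apply]
  split_ifs <;> simp

/-- A large, well separated family of block matrices in the class, close to a common center. -/
theorem exists_separated_family {r k l : ℕ} (hr : 0 < r) (hlk : l ≤ k) (hl : 0 < l) {p lam : ℝ}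
    (hp : 0 < p) (hlam : 1 / (8 * l * p) ≤ lam) :
    ∃ (T : Finset (Fin (r * k) → Bool)) (M : T → Matrix (Fin (r * k)) (Fin (r * l)) ℝ)
      (C : Matrix (Fin (r * k)) (Fin (r * l)) ℝ),
      Real.exp ((r * k : ℕ) / 8) ≤ Fintype.card T ∧
      (∀ v, M v ∈ matrixClass (r * k) (r * l) r lam √(k * lam)) ∧
      (∀ i j, 0 ≤ C i j) ∧ (∀ v i j, C i j = 0 → M v i j = 0) ∧
      (∀ v, p * ∑ i, ∑ j, (M v i j - C i j) ^ 2 / C i j ≤ ((r * k : ℕ) : ℝ) / 16) ∧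
      ∀ v w, v ≠ w → 2 * (√(r : ℝ) * √(k * lam) / (8 * √(2 * p))) ≤ ‖M v - M w‖ := by
  have hl' : (0 : ℝ) < l := by exact_mod_cast hl
  have hlam0 : 0 < lam := lt_of_lt_of_le (by positivity) hlam
  obtain ⟨T, hT, hsep⟩ := exists_hammingDist_packing (Fin (r * k))
  rw [Fintype.card_fin] at hT hsep
  -- This size makes the divergence bound equal to `r * k / 16`; the lower bound on `lam` says
  -- exactly that `δ ≤ lam`.
  set δ : ℝ := √(lam / (8 * l * p)) with hδ
  have hδ0 : 0 < δ := Real.sqrt_pos.2 (by positivity)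
  have hδ2 : δ ^ 2 = lam / (8 * l * p) := Real.sq_sqrt (by positivity)
  have hδlam : δ ≤ lam := by
    refine Real.sqrt_le_iff.2 ⟨hlam0.le, ?_⟩
    rw [div_eq_mul_one_div, sq]
    gcongr
  set u : (Fin (r * k) → Bool) → Fin (r * k) → ℝ := fun v i => if v i then lam else lam - δ with hu
  -- The center takes the midpoint of the two values, at distance `δ / 2` from each and at least
  -- `lam / 2`; hence each term is at most `δ ^ 2 / (2 * lam)`.
  refine ⟨T, fun v => blockMatrix r k l (u v), blockMatrix r k l fun _ => lam - δ / 2, ?_,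
    fun v => ?_, fun i j => ?_, fun v i j => ?_, fun v => ?_, fun v w hvw => ?_⟩
  · simpa using hT
  · refine blockMatrix_mem_matrixClass hr hlk hl fun i => ?_
    simp only [hu]
    split_ifs <;> constructor <;> linarith
  · simp only [blockMatrix, Matrix.of_apply]
    split_ifs <;> linarith
  · simp only [blockMatrix, Matrix.of_apply]
    split_ifs
    · intro h; linarith
    · simp
  · have hle : ∀ i j, (blockMatrix r k l (u v) i j -
        blockMatrix r k l (fun _ => lam - δ / 2) i j) ^ 2 /
          blockMatrix r k l (fun _ => lam - δ / 2) i j ≤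
        if i.divNat = j.divNat then δ ^ 2 / (2 * lam) else 0 := by
      intro i j
      simp only [blockMatrix, Matrix.of_apply, hu]
      by_cases hij : i.divNat = j.divNat
      · have h1 : ((if v.1 i then lam else lam - δ) - (lam - δ / 2)) ^ 2 = δ ^ 2 / 4 := by
          split_ifs <;> ring
        simp only [hij, if_true, h1]
        rw [div_le_div_iff₀ (by linarith) (by linarith)]
        nlinarith [sq_nonneg δ]
      · simp [hij]
    calc p * _ ≤ p * ∑ i : Fin (r * k), ∑ j : Fin (r * l),
          (if i.divNat = j.divNat then δ ^ 2 / (2 * lam) else 0) := by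
          gcongr with i _ j _
          exact hle i j
      _ = ((r * k : ℕ) : ℝ) / 16 := by
          simp_rw [sum_ite_divNat]
          rw [Finset.sum_const, Finset.card_univ, Fintype.card_fin, nsmul_eq_mul, hδ2]
          field_simp
          ring
  · refine le_of_sq_le_sq ?_ (norm_nonneg _)
    rw [norm_sq_blockMatrix_sub]
    have h1 : ∀ i, (u v i - u w i) ^ 2 = if v.1 i ≠ w.1 i then δ ^ 2 else 0 := by
      intro i
      simp only [hu]
      cases v.1 i <;> cases w.1 i <;> simp
    simp_rw [h1]
    rw [← Finset.sum_filter, Finset.sum_const, nsmul_eq_mul]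
    have h2 := hsep v v.2 w w.2 fun h => hvw (Subtype.ext h)
    have h3 : (2 * (√(r : ℝ) * √(k * lam) / (8 * √(2 * p)))) ^ 2 =
        l * (((r * k : ℕ) : ℝ) / 4 * δ ^ 2) := by
      rw [mul_pow, div_pow, mul_pow, mul_pow, Real.sq_sqrt (by positivity),
        Real.sq_sqrt (by positivity), Real.sq_sqrt (by positivity), hδ2]
      push_cast
      field_simp
      ring
    rw [h3]
    gcongr
    exact h2

/-! ### Transposition and the minimax bound. -/

theorem transpose_mem_matrixClass {m n r : ℕ} {lam σ : ℝ} {M : Matrix (Fin m) (Fin n) ℝ}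
    (hM : M ∈ matrixClass m n r lam σ) : M.transpose ∈ matrixClass n m r lam σ := by
  obtain ⟨h1, h2, h3⟩ := hM
  refine ⟨fun i j => h1 j i, ?_, ?_⟩
  · rwa [Matrix.rank_transpose]
  · rw [add_comm]
    exact h3

theorem theorem3 (r k l : ℕ) (hr : 0 < r) (hk : 0 < k) (hl : 0 < l)
    (m n : ℕ) (hm : m = r * k) (hn : n = r * l)
    (p : unitInterval) (hp : 0 < (p : ℝ))
    (lam σ : ℝ) (hlam : 1 / (8 * (min k l : ℕ) * (p : ℝ)) ≤ lam)
    (hσ : σ = √((max k l : ℕ) * lam)) :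
    ENNReal.ofReal (1 / 2 - 8 * Real.log 2 / (max m n : ℕ)) ≤
      ⨅ (Mhat : Observation m n → Matrix (Fin m) (Fin n) ℝ)
        (_ : ∀ i j, Measurable fun y => Mhat y i j),
        ⨆ M ∈ matrixClass m n r lam σ,
          obsLaw p M {y | √(r : ℝ) * σ / (8 * √(2 * (p : ℝ))) ≤ ‖Mhat y - M‖} := by
  subst hm hn hσ
  refine le_iInf₂ fun f hf => ?_
  rcases le_total l k with hlk | hkl
  · rw [min_eq_right hlk] at hlam
    rw [max_eq_left hlk, max_eq_left (Nat.mul_le_mul_left r hlk)]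
    obtain ⟨T, M, C, hcard, hMS, hC, hMC, hdiv, hsep⟩ := exists_separated_family hr hlk hl hp hlam
    exact ofReal_le_iSup_obsLaw_of_separated p _ M C hMS (fun v i j => ((hMS v).1 i j).1) hC hMC
      (Nat.mul_pos hr hk) hcard hdiv hsep hf
  · rw [min_eq_left hkl] at hlam
    rw [max_eq_right hkl, max_eq_right (Nat.mul_le_mul_left r hkl)]
    obtain ⟨T, M, C, hcard, hMS, hC, hMC, hdiv, hsep⟩ := exists_separated_family hr hkl hk hp hlam
    -- Only the family is transposed: class membership, chi-square sums and Frobenius distances are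
    -- all preserved, so the estimator and the observation stay as they are.
    refine ofReal_le_iSup_obsLaw_of_separated p _ (fun v => (M v).transpose) C.transpose
      (fun v => transpose_mem_matrixClass (hMS v)) (fun v i j => ((hMS v).1 j i).1)
      (fun i j => hC j i) (fun v i j => hMC v j i) (Nat.mul_pos hr hl) hcard (fun v => ?_)
      (fun v w hvw => ?_) hf
    · rw [Finset.sum_comm]
      exact hdiv v
    · rw [← Matrix.transpose_sub, Matrix.frobenius_norm_transpose]
      exact hsep v w hvw
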